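/- Let $(M,g)$ be a smooth Riemannian or Lorentzian manifold (without boundary; Lorentzian signature $(-,+,\dots,+)$), and let $H_1,H_2\subset M$ be smooth embedded hypersurfaces. Let $I_\lambda,I_t\subset\mathbb R$ be open intervals with $0\in I_\lambda$ and $[0,\tau_0]\subset I_t$, where $\tau_0\ge 0$, and let $\Gamma:I_\lambda\times I_t\to M$ be a smooth one-parameter family of geodesics, i.e. $\Gamma$ is smooth and each $\gamma_\lambda:=\Gamma(\lambda,\cdot)$ is an affinely parametrized geodesic of $g$. Suppose that $x_0=\gamma_0(0)\in H_1$ and that $\gamma_0$ hits $H_2$ transversally at $y_0=\gamma_0(\tau_0)$. Put $x(\lambda)=\gamma_\lambda(0)$ and $h(\lambda)=g(\dot\gamma_\lambda(0),\dot\gamma_\lambda(0))$. Then there are $\varepsilon,\delta>0$ with $(-\varepsilon,\varepsilon)\subset I_\lambda$, $(\tau_0-\delta,\tau_0+\delta)\subset I_t$ such that for every $|\lambda|<\varepsilon$ there is exactly one $\tau_\lambda\in(\tau_0-\delta,\tau_0+\delta)$ with $\gamma_\lambda(\tau_\lambda)\in H_2$ (the travel time; at $\lambda=0$ it is the given $\tau_0$).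 The intersection of $\gamma_\lambda$ with $H_2$ at $\tau_\lambda$ is transversal, $\lambda\mapsto\tau_\lambda$ is smooth on $(-\varepsilon,\varepsilon)$, and $g(\dot\gamma_\lambda(t),\dot\gamma_\lambda(t))=h(\lambda)$ for all $t\in I_t$. With $y(\lambda)=\gamma_\lambda(\tau_\lambda)$, the functions $h,x,y$ are differentiable on $(-\varepsilon,\varepsilon)$ and $$2h(\lambda)\frac{d\tau_\lambda}{d\lambda}+h'(\lambda)\tau_\lambda=2g\big(y'(\lambda),\dot\gamma_\lambda(\tau_\lambda)\big)-2g\big(x'(\lambda),\dot\gamma_\lambda(0)\big)\qquad(|\lambda|<\varepsilon).$$ In particular, if $h(0)=0$ (that is, $\gamma_0$ is null) and $h'(0)\neq0$, then $$\tau_0=\frac{2}{h'(0)}\Big(g\big(y'(0),\dot\gamma_0(\tau_0)\big)-g\big(x'(0),\dot\gamma_0(0)\big)\Big).$$ -/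

import Mathlib

open scoped Manifold ContDiff Bundle

noncomputable section

/-- A smooth pseudo-Riemannian metric on a smooth manifold `M` modelled on `E`: a smooth section
of the bundle of bilinear forms on the tangent spaces which is symmetric and nondegenerate
at every point. -/
structure PseudoRiemannianMetric (E : Type*) [NormedAddCommGroup E] [NormedSpace ℝ E]
    (M : Type*) [TopologicalSpace M] [ChartedSpace E M] [IsManifold 𝓘(ℝ, E) ∞ M] where
  /-- the bilinear form on the tangent space at `x` -/
  val (x : M) : TangentSpace 𝓘(ℝ, E) x →L[ℝ] TangentSpace 𝓘(ℝ, E) x →L[ℝ] ℝ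
  symm (x : M) (v w : TangentSpace 𝓘(ℝ, E) x) : val x v w = val x w v
  nondegenerate (x : M) (v : TangentSpace 𝓘(ℝ, E) x) (hv : ∀ w, val x v w = 0) : v = 0
  contMDiff : ContMDiff 𝓘(ℝ, E) (𝓘(ℝ, E).prod 𝓘(ℝ, E →L[ℝ] E →L[ℝ] ℝ)) ∞
    (fun x ↦ Bundle.TotalSpace.mk' (E →L[ℝ] E →L[ℝ] ℝ)
      (E := fun x : M ↦ TangentSpace 𝓘(ℝ, E) x →L[ℝ] TangentSpace 𝓘(ℝ, E) x →L[ℝ] ℝ) x (val x))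

section Metric

variable {E : Type*} [NormedAddCommGroup E] [NormedSpace ℝ E]
  {M : Type*} [TopologicalSpace M] [ChartedSpace E M] [IsManifold 𝓘(ℝ, E) ∞ M]

/-- The metric is positive definite at every point. -/
def PseudoRiemannianMetric.IsRiemannian (g : PseudoRiemannianMetric E M) : Prop :=
  ∀ (x : M) (v : TangentSpace 𝓘(ℝ, E) x), v ≠ 0 → 0 < g.val x v v

/-- The metric has signature `(-, +, …, +)` at every point: there is a timelike vector on whose
orthogonal complement the metric is positive definite. -/
def PseudoRiemannianMetric.IsLorentzian (g : PseudoRiemannianMetric E M) : Prop :=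
  ∀ x : M, ∃ v : TangentSpace 𝓘(ℝ, E) x, g.val x v v < 0 ∧
    ∀ w : TangentSpace 𝓘(ℝ, E) x, g.val x v w = 0 → w ≠ 0 → 0 < g.val x w w

/-- The metric in the coordinates of the chart `e`, at the point `p` of the target of `e`:
the bilinear form `G_p(u, v) = g(dψ_p u, dψ_p v)` on `E`, where `ψ = e⁻¹`. -/
def PseudoRiemannianMetric.coord (g : PseudoRiemannianMetric E M) (e : OpenPartialHomeomorph M E)
    (p : E) : E →L[ℝ] E →L[ℝ] ℝ :=
  let B : E →L[ℝ] E →L[ℝ] ℝ := g.val (e.symm p)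
  let dψ : E →L[ℝ] E := mfderiv 𝓘(ℝ, E) 𝓘(ℝ, E) e.symm p
  B.bilinearComp dψ dψ

/-- `G_p(u, v) = g(dψ_p u, dψ_p v)`. -/
theorem PseudoRiemannianMetric.coord_apply (g : PseudoRiemannianMetric E M)
    (e : OpenPartialHomeomorph M E) (p u v : E) :
    g.coord e p u v = g.val (e.symm p) (mfderiv 𝓘(ℝ, E) 𝓘(ℝ, E) e.symm p u)
      (mfderiv 𝓘(ℝ, E) 𝓘(ℝ, E) e.symm p v) :=
  rfl

/-- The Christoffel symbols of the first kind of the Levi-Civita connection, in the chart `e`: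
the linear form `w ↦ ½ ((∂_u G)(v, w) + (∂_v G)(u, w) - (∂_w G)(u, v))`. -/
def PseudoRiemannianMetric.christoffelLower (g : PseudoRiemannianMetric E M)
    (e : OpenPartialHomeomorph M E) (p u v : E) : E →L[ℝ] ℝ :=
  (1 / 2 : ℝ) • (fderiv ℝ (g.coord e) p u v + fderiv ℝ (g.coord e) p v u
    - ((fderiv ℝ (g.coord e) p).flip u).flip v)

/-- The Christoffel symbols (of the second kind) of the Levi-Civita connection, in the chart `e`:
the vector `z = Γ_p(u, v)` with `G_p(z, w) = ½ ((∂_u G)(v, w) + (∂_v G)(u, w) - (∂_w G)(u, v))`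
for all `w`, see `PseudoRiemannianMetric.coord_christoffel`. -/
def PseudoRiemannianMetric.christoffel (g : PseudoRiemannianMetric E M)
    (e : OpenPartialHomeomorph M E) (p u v : E) : E :=
  ContinuousLinearMap.inverse (g.coord e p) (g.christoffelLower e p u v)

theorem PseudoRiemannianMetric.isInvertible_coord [FiniteDimensional ℝ E]
    (g : PseudoRiemannianMetric E M) {e : OpenPartialHomeomorph M E} (he : e ∈ atlas E M)
    {p : E} (hp : p ∈ e.target) : (g.coord e p).IsInvertible := by
  have he' : e.MDifferentiable 𝓘(ℝ, E) 𝓘(ℝ, E) := by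
    have := mdifferentiable_of_mem_atlas (I := 𝓘(ℝ, E)) he
    simpa using this
  have hinj : Function.Injective (mfderiv 𝓘(ℝ, E) 𝓘(ℝ, E) e.symm p) :=
    he'.symm.mfderiv_injective hp
  have hsurj : Function.Surjective (mfderiv 𝓘(ℝ, E) 𝓘(ℝ, E) e.symm p) :=
    he'.symm.mfderiv_surjective hp
  have hG : Function.Injective (g.coord e p) := by
    rw [injective_iff_map_eq_zero]
    intro u hu
    refine hinj ?_
    refine (g.nondegenerate (e.symm p) _ fun w ↦ ?_).trans
      (map_zero (mfderiv 𝓘(ℝ, E) 𝓘(ℝ, E) e.symm p)).symm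
    obtain ⟨u', rfl⟩ := hsurj w
    exact (g.coord_apply e p u u').symm.trans (by rw [hu]; rfl)
  have hfin : Module.finrank ℝ E = Module.finrank ℝ (E →L[ℝ] ℝ) := by
    rw [← Subspace.dual_finrank_eq]
    exact (LinearMap.toContinuousLinearMap (𝕜 := ℝ) (E := E) (F' := ℝ)).finrank_eq
  exact ⟨(LinearEquiv.ofInjectiveOfFinrankEq
    (g.coord e p).toLinearMap hG hfin).toContinuousLinearEquiv, rfl⟩

theorem PseudoRiemannianMetric.coord_christoffel [FiniteDimensional ℝ E]
    (g : PseudoRiemannianMetric E M) {e : OpenPartialHomeomorph M E} (he : e ∈ atlas E M)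
    {p : E} (hp : p ∈ e.target) (u v w : E) :
    g.coord e p (g.christoffel e p u v) w =
      1 / 2 * (fderiv ℝ (g.coord e) p u v w + fderiv ℝ (g.coord e) p v u w
        - fderiv ℝ (g.coord e) p w u v) := by
  obtain ⟨L, hL⟩ := g.isInvertible_coord he hp
  have : g.coord e p (g.christoffel e p u v) = g.christoffelLower e p u v := by
    rw [PseudoRiemannianMetric.christoffel, ← hL, ContinuousLinearMap.inverse_equiv]
    exact L.apply_symm_apply _
  rw [this]
  simp [PseudoRiemannianMetric.christoffelLower]

/-- The velocity `ċ(t) ∈ T_{c(t)} M` of a curve `c` in `M`. -/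
def velocity (c : ℝ → M) (t : ℝ) : TangentSpace 𝓘(ℝ, E) (c t) :=
  mfderiv 𝓘(ℝ, ℝ) 𝓘(ℝ, E) c t (1 : ℝ)

/-- `γ` is a geodesic of `g` (affinely parametrized) on the open set `s` of times: it is smooth
and satisfies the geodesic equation `c'' + Γ_c(c', c') = 0` in every chart. -/
structure PseudoRiemannianMetric.IsGeodesicOn (g : PseudoRiemannianMetric E M) (γ : ℝ → M)
    (s : Set ℝ) : Prop where
  contMDiffOn : ContMDiffOn 𝓘(ℝ, ℝ) 𝓘(ℝ, E) ∞ γ s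
  geodesic_eq : ∀ t ∈ s, ∀ e ∈ atlas E M, γ t ∈ e.source →
    deriv (deriv (e ∘ γ)) t +
      g.christoffel e (e (γ t)) (deriv (e ∘ γ) t) (deriv (e ∘ γ) t) = 0

end Metric

section Hypersurface

variable (E : Type*) [NormedAddCommGroup E] [NormedSpace ℝ E]
  {M : Type*} [TopologicalSpace M] [ChartedSpace E M]

/-- `φ` is a local defining function of `S` on the open set `U`: it is smooth on `U`, its zero
set in `U` is `S ∩ U`, and its differential does not vanish at any point of `S ∩ U`. -/
structure IsLocalDefiningFunction (S U : Set M) (φ : M → ℝ) : Prop where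
  isOpen : IsOpen U
  contMDiffOn : ContMDiffOn 𝓘(ℝ, E) 𝓘(ℝ, ℝ) ∞ φ U
  mem_iff : ∀ q ∈ U, q ∈ S ↔ φ q = 0
  mfderiv_ne_zero : ∀ q ∈ S ∩ U, mfderiv 𝓘(ℝ, E) 𝓘(ℝ, ℝ) φ q ≠ 0

/-- `S` is a smooth (embedded) hypersurface of `M`. -/
def IsSmoothHypersurface (S : Set M) : Prop :=
  ∀ p ∈ S, ∃ (U : Set M) (φ : M → ℝ), p ∈ U ∧ IsLocalDefiningFunction E S U φ

variable {E} in
/-- The tangent vector `v` at the point `p` of the hypersurface `S` is transversal to `S`, i.e.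
it does not lie in `T_p S = ker dφ_p`, where `φ` is a local defining function of `S` near `p`
(all of them have the same kernel at `p`). -/
def IsTransversalTo (S : Set M) {p : M} (v : TangentSpace 𝓘(ℝ, E) p) : Prop :=
  p ∈ S ∧ ∃ (U : Set M) (φ : M → ℝ), p ∈ U ∧ IsLocalDefiningFunction E S U φ ∧
    (mfderiv 𝓘(ℝ, E) 𝓘(ℝ, ℝ) φ p v : ℝ) ≠ 0

end Hypersurface

section Family

variable {E : Type*} [NormedAddCommGroup E] [NormedSpace ℝ E]
  {M : Type*} [TopologicalSpace M] [ChartedSpace E M] [IsManifold 𝓘(ℝ, E) ∞ M]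

/-- `Γ(l, t) = γ_l(t)` is a smooth one-parameter family of geodesics on `Il × It`, where `Il`
and `It` are open intervals. -/
structure PseudoRiemannianMetric.IsSmoothGeodesicFamily (g : PseudoRiemannianMetric E M)
    (Γ : ℝ → ℝ → M) (Il It : Set ℝ) : Prop where
  isOpen_param : IsOpen Il
  ordConnected_param : Il.OrdConnected
  isOpen_time : IsOpen It
  ordConnected_time : It.OrdConnected
  contMDiffOn : ContMDiffOn 𝓘(ℝ, ℝ × ℝ) 𝓘(ℝ, E) ∞ (fun z : ℝ × ℝ ↦ Γ z.1 z.2) (Il ×ˢ It)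
  isGeodesicOn : ∀ l ∈ Il, g.IsGeodesicOn (Γ l) It

/-- The quantity `h(l) = g(γ̇_l(0), γ̇_l(0))` of a family of curves. -/
def PseudoRiemannianMetric.energy (g : PseudoRiemannianMetric E M) (Γ : ℝ → ℝ → M) (l : ℝ) : ℝ :=
  g.val (Γ l 0) (velocity (E := E) (Γ l) 0) (velocity (E := E) (Γ l) 0)

end Family

end

/-!
Transversality says that `φ ∘ Γ` has nonzero time derivative, where `φ` is a local defining
function of the hypersurface, so the implicit function theorem yields the travel time. Along the
family `Γ(λ, t) = γ_λ(t)` the Levi-Civita connection gives `∂_t g(γ̇, γ̇) = 2 g(∇_t γ̇, γ̇) = 0` and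
`∂_t g(∂_λ Γ, γ̇) = g(∇_t ∂_λ Γ, γ̇) = g(∇_λ γ̇, γ̇) = h'(λ) / 2`, so `2 g(∂_λ Γ, γ̇)` is affine in
`t` with slope `h'(λ)`. Evaluating it between `t = 0` and `t = τ_λ` and inserting
`y' = ∂_λ Γ + τ' γ̇` gives the first variation formula.
-/

open scoped Topology

section ImplicitFunction

open Metric

theorem exists_contDiffOn_implicitFunction {𝕜 E₁ E₂ F : Type*} [RCLike 𝕜]
    [NormedAddCommGroup E₁] [NormedSpace 𝕜 E₁] [CompleteSpace E₁]
    [NormedAddCommGroup E₂] [NormedSpace 𝕜 E₂] [CompleteSpace E₂]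
    [NormedAddCommGroup F] [NormedSpace 𝕜 F] [CompleteSpace F]
    {f : E₁ × E₂ → F} {W : Set (E₁ × E₂)} {n : WithTop ℕ∞} (hn : n ≠ 0) (hW : IsOpen W)
    (hf : ContDiffOn 𝕜 n f W) (hf' : ∀ z ∈ W, (fderiv 𝕜 f z ∘L .inr 𝕜 E₁ E₂).IsInvertible)
    {a : E₁} {b : E₂} (hab : (a, b) ∈ W) :
    ∃ ε > 0, ∃ δ > 0, ∃ ψ : E₁ → E₂, ball a ε ×ˢ ball b δ ⊆ W ∧ ψ a = b ∧
      (∀ x ∈ ball a ε, ψ x ∈ ball b δ ∧ ∀ y ∈ ball b δ, f (x, y) = f (a, b) ↔ y = ψ x) ∧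
      ContDiffOn 𝕜 n ψ (ball a ε) := by
  have hfz : ∀ z ∈ W, ContDiffAt 𝕜 n f z := fun z hz ↦ hf.contDiffAt (hW.mem_nhds hz)
  set ψ := (hfz _ hab).implicitFunction hn (hf' _ hab)
  have hψa : ψ a = b := (hfz _ hab).implicitFunction_apply_self hn (hf' _ hab)
  obtain ⟨δ, hδ, hψ_iff⟩ := eventually_nhds_iff_ball.1 ((hW.eventually_mem hab).and
    ((hfz _ hab).eventually_apply_eq_iff_implicitFunction hn (hf' _ hab)))
  have hball : ∀ x ∈ ball a δ, ∀ y ∈ ball b δ, (x, y) ∈ W ∧ (f (x, y) = f (a, b) ↔ y = ψ x) :=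
    fun x hx y hy ↦ (hψ_iff (x, y) (ball_prod_same a b δ ▸ ⟨hx, hy⟩)).imp_right
      fun h ↦ h.trans eq_comm
  have hψ : Filter.Tendsto ψ (𝓝 a) (𝓝 b) :=
    hψa ▸ ((hfz _ hab).contDiffAt_implicitFunction hn (hf' _ hab)).continuousAt
  obtain ⟨ε, hε, hεδ⟩ := eventually_nhds_iff_ball.1
    ((isOpen_ball.eventually_mem (mem_ball_self hδ)).and (hψ.eventually_mem (ball_mem_nhds b hδ)))
  refine ⟨ε, hε, δ, hδ, ψ, fun z hz ↦ (hball _ (hεδ _ hz.1).1 _ hz.2).1, hψa,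
    fun x hx ↦ ⟨(hεδ x hx).2, fun y hy ↦ (hball x (hεδ x hx).1 y hy).2⟩, fun x hx ↦ ?_⟩
  obtain ⟨hxδ, hψx⟩ := hεδ x hx
  obtain ⟨hxW, hfx⟩ := hball x hxδ _ hψx
  -- `ψ` is only known to be smooth at `a`; near `x` it agrees with the implicit function at `x`.
  set ψ' := (hfz _ hxW).implicitFunction hn (hf' _ hxW)
  have hψ' : ContDiffAt 𝕜 n ψ' x := (hfz _ hxW).contDiffAt_implicitFunction hn (hf' _ hxW)
  have hψ'x : ψ' x = ψ x := (hfz _ hxW).implicitFunction_apply_self hn (hf' _ hxW)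
  have hψψ' : ψ =ᶠ[𝓝 x] ψ' := by
    filter_upwards [isOpen_ball.mem_nhds hxδ,
      hψ'.continuousAt.eventually_mem (hψ'x ▸ isOpen_ball.mem_nhds hψx),
      (hfz _ hxW).eventually_apply_implicitFunction hn (hf' _ hxW)] with y hy hψ'y hfy
    exact ((hball y hy _ hψ'y).2.1 (hfy.trans (hfx.2 rfl))).symm
  exact (hψ'.congr_of_eventuallyEq hψψ').contDiffWithinAt

theorem isInvertible_of_apply_one_ne_zero {𝕜 : Type*}
    [NontriviallyNormedField 𝕜] {L : 𝕜 →L[𝕜] 𝕜} (hL : L 1 ≠ 0) : L.IsInvertible :=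
  ⟨ContinuousLinearEquiv.unitsEquivAut 𝕜 (Units.mk0 (L 1) hL), by ext; simp⟩

end ImplicitFunction

section PartialDerivative

variable {𝕜 : Type*} [NontriviallyNormedField 𝕜]
  {X : Type*} [NormedAddCommGroup X] [NormedSpace 𝕜 X]
  {Y : Type*} [NormedAddCommGroup Y] [NormedSpace 𝕜 Y]
  {f : X × 𝕜 → Y} {x : X} {t : 𝕜}

theorem hasDerivAt_prodMk_right (x : X) (t : 𝕜) :
    HasDerivAt (fun s : 𝕜 ↦ (x, s)) ((0, 1) : X × 𝕜) t :=
  (hasDerivAt_const t x).prodMk (hasDerivAt_id t)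

theorem hasDerivAt_comp_prodMk_right (hf : DifferentiableAt 𝕜 f (x, t)) :
    HasDerivAt (fun s ↦ f (x, s)) (fderiv 𝕜 f (x, t) (0, 1)) t :=
  hf.hasFDerivAt.comp_hasDerivAt t (hasDerivAt_prodMk_right x t)

theorem deriv_deriv_comp_prodMk_right (hf : ContDiffAt 𝕜 2 f (x, t)) :
    deriv (deriv fun s ↦ f (x, s)) t = fderiv 𝕜 (fderiv 𝕜 f) (x, t) (0, 1) (0, 1) := by
  have hderiv : deriv (fun s ↦ f (x, s)) =ᶠ[𝓝 t] fun s ↦ fderiv 𝕜 f (x, s) (0, 1) := by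
    filter_upwards [(hasDerivAt_prodMk_right x t).continuousAt.eventually
      (hf.eventually (by simp))] with s hs
    exact (hasDerivAt_comp_prodMk_right (hs.differentiableAt (by simp))).deriv
  have hf' : DifferentiableAt 𝕜 (fderiv 𝕜 f) (x, t) :=
    (hf.fderiv_right (m := 1) (by norm_num)).differentiableAt (by simp)
  have hsnd := (hasDerivAt_comp_prodMk_right hf').clm_apply
    (hasDerivAt_const t ((0, 1) : X × 𝕜))
  rw [hderiv.deriv_eq, hsnd.deriv, map_zero, add_zero]

end PartialDerivative

section Velocity

open Function Metric

variable {E : Type*} [NormedAddCommGroup E] [NormedSpace ℝ E]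
  {M : Type*} [TopologicalSpace M] [ChartedSpace E M]
  {X : Type*} [NormedAddCommGroup X] [NormedSpace ℝ X]

theorem velocity_comp {F : X → M} {c : ℝ → X} {c' : X} {s : ℝ}
    (hF : MDifferentiableAt 𝓘(ℝ, X) 𝓘(ℝ, E) F (c s)) (hc : HasDerivAt c c' s) :
    velocity (E := E) (F ∘ c) s = mfderiv 𝓘(ℝ, X) 𝓘(ℝ, E) F (c s) c' := by
  have hc' : mfderiv 𝓘(ℝ, ℝ) 𝓘(ℝ, X) c s (1 : ℝ) = c' := by
    rw [mfderiv_eq_fderiv]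
    exact hc.deriv
  rw [velocity, mfderiv_comp s hF hc.differentiableAt.mdifferentiableAt]
  exact congrArg (mfderiv 𝓘(ℝ, X) 𝓘(ℝ, E) F (c s)) hc'

theorem velocity_eq_mfderiv_uncurry {Γ : X → ℝ → M} {x : X} {t : ℝ}
    (hΓ : MDifferentiableAt 𝓘(ℝ, X × ℝ) 𝓘(ℝ, E) (uncurry Γ) (x, t)) :
    velocity (E := E) (Γ x) t =
      mfderiv 𝓘(ℝ, X × ℝ) 𝓘(ℝ, E) (uncurry Γ) (x, t) ((0, 1) : X × ℝ) :=
  velocity_comp (F := uncurry Γ) (c := fun s ↦ (x, s)) hΓ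
    (hasDerivAt_prodMk_right x t)

theorem velocity_graph {Γ : ℝ → ℝ → M} {τ : ℝ → ℝ} {l : ℝ}
    (hΓ : MDifferentiableAt 𝓘(ℝ, ℝ × ℝ) 𝓘(ℝ, E) (uncurry Γ) (l, τ l))
    (hτ : DifferentiableAt ℝ τ l) :
    velocity (E := E) (fun s ↦ Γ s (τ s)) l =
      mfderiv 𝓘(ℝ, ℝ × ℝ) 𝓘(ℝ, E) (uncurry Γ) (l, τ l) ((1, deriv τ l) : ℝ × ℝ) :=
  velocity_comp (F := uncurry Γ) (c := fun s ↦ (s, τ s)) hΓ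
    ((hasDerivAt_id l).prodMk hτ.hasDerivAt)

theorem fderiv_comp_uncurry_apply {Γ : X → ℝ → M} {φ : M → ℝ} {x : X} {t : ℝ}
    (hφ : MDifferentiableAt 𝓘(ℝ, E) 𝓘(ℝ, ℝ) φ (Γ x t))
    (hΓ : MDifferentiableAt 𝓘(ℝ, X × ℝ) 𝓘(ℝ, E) (uncurry Γ) (x, t)) :
    fderiv ℝ (φ ∘ uncurry Γ) (x, t) (0, 1) =
      mfderiv 𝓘(ℝ, E) 𝓘(ℝ, ℝ) φ (Γ x t) (velocity (E := E) (Γ x) t) := by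
  rw [velocity_eq_mfderiv_uncurry hΓ, ← mfderiv_eq_fderiv, mfderiv_comp (x, t) hφ hΓ]
  rfl

theorem IsTransversalTo.exists_hittingTime [CompleteSpace X] {S : Set M} {Γ : X → ℝ → M}
    {W : Set (X × ℝ)} (hW : IsOpen W)
    (hΓ : ContMDiffOn 𝓘(ℝ, X × ℝ) 𝓘(ℝ, E) ∞ (uncurry Γ) W) {x₀ : X} {t₀ : ℝ}
    (h₀ : (x₀, t₀) ∈ W) (hS : IsTransversalTo S (velocity (E := E) (Γ x₀) t₀)) :
    ∃ ε > 0, ∃ δ > 0, ∃ τ : X → ℝ, ball x₀ ε ×ˢ ball t₀ δ ⊆ W ∧ τ x₀ = t₀ ∧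
      (∀ x ∈ ball x₀ ε, τ x ∈ ball t₀ δ ∧ ∀ t ∈ ball t₀ δ, Γ x t ∈ S ↔ t = τ x) ∧
      (∀ x ∈ ball x₀ ε, IsTransversalTo S (velocity (E := E) (Γ x) (τ x))) ∧
      ContDiffOn ℝ ∞ τ (ball x₀ ε) := by
  obtain ⟨hmem, U, φ, hU, hφ, hne⟩ := hS
  set f : X × ℝ → ℝ := φ ∘ uncurry Γ
  set V : Set (X × ℝ) := W ∩ uncurry Γ ⁻¹' U
  have hV : IsOpen V := hΓ.continuousOn.isOpen_inter_preimage hW hφ.isOpen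
  have hf : ContDiffOn ℝ ∞ f V :=
    (hφ.contMDiffOn.comp (hΓ.mono Set.inter_subset_left) fun z hz ↦ hz.2).contDiffOn
  have hft : ∀ x t, (x, t) ∈ V → fderiv ℝ f (x, t) (0, 1) =
      mfderiv 𝓘(ℝ, E) 𝓘(ℝ, ℝ) φ (Γ x t) (velocity (E := E) (Γ x) t) := fun x t hz ↦
    fderiv_comp_uncurry_apply
      ((hφ.contMDiffOn.contMDiffAt (hφ.isOpen.mem_nhds hz.2)).mdifferentiableAt (by simp))
      ((hΓ.contMDiffAt (hW.mem_nhds hz.1)).mdifferentiableAt (by simp))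
  set V' : Set (X × ℝ) := V ∩ (fun z ↦ fderiv ℝ f z (0, 1)) ⁻¹' {0}ᶜ
  have hV' : IsOpen V' := ((hf.continuousOn_fderiv_of_isOpen hV (by simp)).clm_apply
    continuousOn_const).isOpen_inter_preimage hV isOpen_compl_singleton
  have h₀V : (x₀, t₀) ∈ V := ⟨h₀, hU⟩
  obtain ⟨ε, hε, δ, hδ, τ, hbox, hτ₀, hτ, hτs⟩ := exists_contDiffOn_implicitFunction
    (by simp) hV' (hf.mono Set.inter_subset_left)
    (fun z hz ↦ isInvertible_of_apply_one_ne_zero hz.2)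
    ⟨h₀V, (hft _ _ h₀V).trans_ne hne⟩
  have hf₀ : f (x₀, t₀) = 0 := (hφ.mem_iff _ hU).1 hmem
  have hmeet : ∀ x ∈ ball x₀ ε, ∀ t ∈ ball t₀ δ, Γ x t ∈ S ↔ t = τ x := fun x hx t ht ↦
    (hφ.mem_iff _ (hbox (Set.mk_mem_prod hx ht)).1.2).trans (hf₀ ▸ (hτ x hx).2 t ht)
  refine ⟨ε, hε, δ, hδ, τ, fun z hz ↦ (hbox hz).1.1, hτ₀,
    fun x hx ↦ ⟨(hτ x hx).1, hmeet x hx⟩, fun x hx ↦ ?_, hτs⟩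
  obtain ⟨hxV, hne'⟩ := hbox (Set.mk_mem_prod hx (hτ x hx).1)
  exact ⟨(hmeet x hx _ (hτ x hx).1).2 rfl, U, φ, hxV.2, hφ, (hft _ _ hxV).symm.trans_ne hne'⟩

end Velocity

section Bilinear

variable {𝕜 : Type*} [NontriviallyNormedField 𝕜]
  {X : Type*} [NormedAddCommGroup X] [NormedSpace 𝕜 X]
  {Y : Type*} [NormedAddCommGroup Y] [NormedSpace 𝕜 Y]
  {Z : Type*} [NormedAddCommGroup Z] [NormedSpace 𝕜 Z]
  {G : Type*} [NormedAddCommGroup G] [NormedSpace 𝕜 G]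

theorem hasFDerivAt_apply_apply {B : X → Y →L[𝕜] Z →L[𝕜] G} {x : X}
    (hB : DifferentiableAt 𝕜 B x) (y : Y) (z : Z) :
    HasFDerivAt (fun x ↦ B x y z) (((fderiv 𝕜 B x).flip y).flip z) x := by
  refine ((hB.hasFDerivAt.clm_apply (hasFDerivAt_const y x)).clm_apply
    (hasFDerivAt_const z x)).congr_fderiv ?_
  ext
  simp

theorem fderiv_flip_apply (B : X → Y →L[𝕜] Z →L[𝕜] G) (x w : X) :
    fderiv 𝕜 (fun x ↦ (B x).flip) x w = (fderiv 𝕜 B x w).flip := by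
  have h := LinearIsometryEquiv.comp_fderiv (𝕜 := 𝕜) (E := Y →L[𝕜] Z →L[𝕜] G)
    (F := Z →L[𝕜] Y →L[𝕜] G) (ContinuousLinearMap.flipₗᵢ 𝕜 Y Z G) (f := B) (x := x)
  exact DFunLike.congr_fun h w

theorem differentiableAt_flip {B : X → Y →L[𝕜] Z →L[𝕜] G} {x : X}
    (hB : DifferentiableAt 𝕜 B x) : DifferentiableAt 𝕜 (fun x ↦ (B x).flip) x := by
  have h := LinearIsometryEquiv.comp_differentiableAt_iff (𝕜 := 𝕜) (E := Y →L[𝕜] Z →L[𝕜] G)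
    (F := Z →L[𝕜] Y →L[𝕜] G) (ContinuousLinearMap.flipₗᵢ 𝕜 Y Z G) (f := B) (x := x)
  exact h.2 hB

section BilinearComp

variable {V : Type*} [NormedAddCommGroup V] [NormedSpace 𝕜 V]
  {B : V → Y →L[𝕜] Y →L[𝕜] G} {C : X → V} {A : X → Z →L[𝕜] Y} {x : X}

theorem differentiableAt_bilinearComp (hB : DifferentiableAt 𝕜 B (C x))
    (hC : DifferentiableAt 𝕜 C x) (hA : DifferentiableAt 𝕜 A x) :
    DifferentiableAt 𝕜 (fun x ↦ (B (C x)).bilinearComp (A x) (A x)) x :=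
  differentiableAt_flip ((differentiableAt_flip ((hB.comp x hC).clm_comp hA)).clm_comp hA)

theorem fderiv_bilinearComp_apply (hB : DifferentiableAt 𝕜 B (C x))
    (hC : DifferentiableAt 𝕜 C x) (hA : DifferentiableAt 𝕜 A x) (w : X) (a b : Z) :
    fderiv 𝕜 (fun x ↦ (B (C x)).bilinearComp (A x) (A x)) x w a b =
      fderiv 𝕜 B (C x) (fderiv 𝕜 C x w) (A x a) (A x b) +
        B (C x) (fderiv 𝕜 A x w a) (A x b) + B (C x) (A x a) (fderiv 𝕜 A x w b) := by
  have hA' : ∀ c, HasFDerivAt (fun x ↦ A x c) ((fderiv 𝕜 A x).flip c) x := fun c ↦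
    (hA.hasFDerivAt.clm_apply (hasFDerivAt_const c x)).congr_fderiv (by ext; simp)
  have hBC : HasFDerivAt (fun x ↦ B (C x)) (fderiv 𝕜 B (C x) ∘L fderiv 𝕜 C x) x :=
    HasFDerivAt.comp (𝕜 := 𝕜) (G := Y →L[𝕜] Y →L[𝕜] G) x hB.hasFDerivAt hC.hasFDerivAt
  have h := (hasFDerivAt_apply_apply (differentiableAt_bilinearComp hB hC hA) a b).unique
    ((hBC.clm_apply (hA' a)).clm_apply (hA' b))
  have hw := DFunLike.congr_fun h w
  simp only [ContinuousLinearMap.flip_apply, ContinuousLinearMap.flip_add,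
    ContinuousLinearMap.coe_coe, add_apply, ContinuousLinearMap.comp_apply] at hw
  rw [hw]
  abel

end BilinearComp

end Bilinear

namespace PseudoRiemannianMetric

variable {E : Type*} [NormedAddCommGroup E] [NormedSpace ℝ E]
  {M : Type*} [TopologicalSpace M] [ChartedSpace E M] [IsManifold 𝓘(ℝ, E) ∞ M]
  {X : Type*} [NormedAddCommGroup X] [NormedSpace ℝ X]
  (g : PseudoRiemannianMetric E M)

section Pullback

/-- The pullback `F^* g` of the metric along a map `F : X → M`, as a bilinear form on `X` at each
point `z`: `(F^* g)_z(a, b) = g(dF_z a, dF_z b)`. In the chart `e`, the coordinate expression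
`g.coord e` is the pullback along `e.symm`. -/
noncomputable def pullback (F : X → M) (z : X) : X →L[ℝ] X →L[ℝ] ℝ :=
  let B : E →L[ℝ] E →L[ℝ] ℝ := g.val (F z)
  let dF : X →L[ℝ] E := mfderiv 𝓘(ℝ, X) 𝓘(ℝ, E) F z
  B.bilinearComp dF dF

theorem pullback_symm (F : X → M) (z a b : X) : g.pullback F z a b = g.pullback F z b a :=
  g.symm (F z) _ _

theorem pullback_congr {F₁ F₂ : X → M} {z : X} (h : F₁ =ᶠ[𝓝 z] F₂) :
    g.pullback F₁ z = g.pullback F₂ z := by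
  let B : M → E →L[ℝ] E →L[ℝ] ℝ := g.val
  exact congrArg₂ (fun (x : M) (A : X →L[ℝ] E) ↦ (B x).bilinearComp A A) h.eq_of_nhds
    h.mfderiv_eq

theorem pullback_comp {Y : Type*} [NormedAddCommGroup Y] [NormedSpace ℝ Y] {F : X → M}
    {C : Y → X} {y : Y} (hF : MDifferentiableAt 𝓘(ℝ, X) 𝓘(ℝ, E) F (C y))
    (hC : DifferentiableAt ℝ C y) :
    g.pullback (F ∘ C) y = (g.pullback F (C y)).bilinearComp (fderiv ℝ C y) (fderiv ℝ C y) := by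
  have h := mfderiv_comp y hF hC.mdifferentiableAt
  rw [mfderiv_eq_fderiv] at h
  ext a b
  change g.val (F (C y)) (mfderiv 𝓘(ℝ, Y) 𝓘(ℝ, E) (F ∘ C) y a)
    (mfderiv 𝓘(ℝ, Y) 𝓘(ℝ, E) (F ∘ C) y b) = _
  rw [h]
  rfl

theorem contDiffOn_pullback [FiniteDimensional ℝ X] {F : X → M} {s : Set X} (hs : IsOpen s)
    (hF : ContMDiffOn 𝓘(ℝ, X) 𝓘(ℝ, E) ∞ F s) : ContDiffOn ℝ ∞ (g.pullback F) s := by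
  have hdF : ∀ a : X, ContMDiffOn 𝓘(ℝ, X) (𝓘(ℝ, E).prod 𝓘(ℝ, E)) ∞
      (fun z ↦ Bundle.TotalSpace.mk' E (E := fun x : M ↦ TangentSpace 𝓘(ℝ, E) x) (F z)
        (mfderiv 𝓘(ℝ, X) 𝓘(ℝ, E) F z a)) s := by
    intro a
    have hconst : ContMDiff 𝓘(ℝ, X) (𝓘(ℝ, X).prod 𝓘(ℝ, X)) ∞
        (fun z : X ↦ (⟨z, a⟩ : TangentBundle 𝓘(ℝ, X) X)) :=
      contMDiff_vectorSpace_iff_contDiff.2 contDiff_const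
    refine ((hF.contMDiffOn_tangentMapWithin (m := ∞) (by simp) hs.uniqueMDiffOn).comp
      hconst.contMDiffOn fun z hz ↦ hz).congr fun z hz ↦ ?_
    simp only [Function.comp_apply, tangentMapWithin, mfderivWithin_of_isOpen hs hz]
  refine contDiffOn_clm_apply.2 fun a ↦ contDiffOn_clm_apply.2 fun b ↦
    contMDiffOn_iff_contDiffOn.1 fun z hz ↦ ?_
  have hval := ContMDiffOn.clm_bundle_apply₂ (F₁ := E) (F₂ := E) (F₃ := ℝ) (b := F)
    (E₁ := fun x : M ↦ TangentSpace 𝓘(ℝ, E) x) (E₂ := fun x : M ↦ TangentSpace 𝓘(ℝ, E) x)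
    (E₃ := Bundle.Trivial M ℝ) (g.contMDiff.comp_contMDiffOn hF) (hdF a) (hdF b)
  exact (Bundle.contMDiffWithinAt_totalSpace.1 (hval z hz)).2

theorem fderiv_pullback_symm (F : X → M) (z w a b : X) :
    fderiv ℝ (g.pullback F) z w a b = fderiv ℝ (g.pullback F) z w b a := by
  have hflip : (fun z ↦ (g.pullback F z).flip) = g.pullback F := by
    ext z a b
    exact g.pullback_symm F z b a
  conv_lhs => rw [← hflip, fderiv_flip_apply]
  rfl

theorem hasDerivAt_pullback_apply {F : X → M} {c : ℝ → X} {c' : X} {s : ℝ}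
    (hF : DifferentiableAt ℝ (g.pullback F) (c s)) (hc : HasDerivAt c c' s) (a b : X) :
    HasDerivAt (fun s ↦ g.pullback F (c s) a b) (fderiv ℝ (g.pullback F) (c s) c' a b) s :=
  (hasFDerivAt_apply_apply hF a b).comp_hasDerivAt s hc

end Pullback

section Christoffel

variable (e : OpenPartialHomeomorph M E)

theorem coord_eq_pullback : g.coord e = g.pullback e.symm := rfl

theorem christoffel_symm (p u v : E) : g.christoffel e p u v = g.christoffel e p v u := by
  have hlower : g.christoffelLower e p u v = g.christoffelLower e p v u := by
    ext w
    simp only [christoffelLower, coord_eq_pullback, ContinuousLinearMap.flip_apply, smul_apply,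
      add_apply, sub_apply, g.fderiv_pullback_symm e.symm p w u v]
    ring
  rw [christoffel, hlower, christoffel]

variable {e}

theorem fderiv_coord_eq_christoffel [FiniteDimensional ℝ E] (he : e ∈ atlas E M) {p : E}
    (hp : p ∈ e.target) (w u v : E) :
    fderiv ℝ (g.coord e) p w u v =
      g.coord e p (g.christoffel e p w u) v + g.coord e p u (g.christoffel e p w v) := by
  have hsymm : ∀ x y z, fderiv ℝ (g.coord e) p x y z = fderiv ℝ (g.coord e) p x z y :=
    g.fderiv_pullback_symm e.symm p
  have hcomm : g.coord e p u (g.christoffel e p w v) = g.coord e p (g.christoffel e p w v) u :=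
    g.pullback_symm e.symm p _ _
  rw [hcomm, g.coord_christoffel he hp, g.coord_christoffel he hp, hsymm w v u, hsymm u w v,
    hsymm v w u]
  ring

theorem differentiableAt_coord [FiniteDimensional ℝ E] (he : e ∈ atlas E M) {p : E}
    (hp : p ∈ e.target) : DifferentiableAt ℝ (g.coord e) p :=
  ((g.contDiffOn_pullback e.open_target (contMDiffOn_symm_of_mem_maximalAtlas
    (IsManifold.subset_maximalAtlas he))).contDiffAt (e.open_target.mem_nhds hp)).differentiableAt
    (by simp)

end Christoffel

section Hessian

variable (e : OpenPartialHomeomorph M E)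

/-- The Hessian `∇dF` of a map `F : X → M` in the chart `e`: `∇_a(dF b)` is the second derivative
of `F` corrected by the Christoffel symbols. For `F(x, t) = γ_x(t)` and `a = b = ∂_t`, its
vanishing is the geodesic equation. -/
noncomputable def coordHessian (F : X → M) (z a b : X) : E :=
  fderiv ℝ (fderiv ℝ (e ∘ F)) z a b +
    g.christoffel e (e (F z)) (fderiv ℝ (e ∘ F) z a) (fderiv ℝ (e ∘ F) z b)

variable {e} {F : X → M} {z : X}

theorem contDiffAt_chart_comp {n : WithTop ℕ∞} (he : e ∈ atlas E M) (hn : n ≤ ∞)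
    (hF : ContMDiffAt 𝓘(ℝ, X) 𝓘(ℝ, E) n F z) (hz : F z ∈ e.source) :
    ContDiffAt ℝ n (e ∘ F) z :=
  (((contMDiffAt_of_mem_maximalAtlas (IsManifold.subset_maximalAtlas he) hz).of_le hn).comp z
    hF).contDiffAt

theorem coordHessian_symm (hF : ContDiffAt ℝ 2 (e ∘ F) z) (a b : X) :
    g.coordHessian e F z a b = g.coordHessian e F z b a := by
  rw [coordHessian, coordHessian, hF.isSymmSndFDerivAt (by simp) a b, g.christoffel_symm]

theorem pullback_eq_coord (he : e ∈ atlas E M) (hF : ContMDiffAt 𝓘(ℝ, X) 𝓘(ℝ, E) 1 F z)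
    (hz : F z ∈ e.source) : g.pullback F z =
      (g.coord e (e (F z))).bilinearComp (fderiv ℝ (e ∘ F) z) (fderiv ℝ (e ∘ F) z) := by
  have hem : e ∈ IsManifold.maximalAtlas 𝓘(ℝ, E) ∞ M := IsManifold.subset_maximalAtlas he
  have hC : ContDiffAt ℝ 1 (e ∘ F) z := contDiffAt_chart_comp he (by simp) hF hz
  have hψ : MDifferentiableAt 𝓘(ℝ, E) 𝓘(ℝ, E) e.symm ((e ∘ F) z) :=
    (contMDiffAt_symm_of_mem_maximalAtlas hem (e.map_source hz)).mdifferentiableAt (by simp)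
  have hF_eq : F =ᶠ[𝓝 z] e.symm ∘ (e ∘ F) := by
    filter_upwards [hF.continuousAt.eventually_mem (e.open_source.mem_nhds hz)] with x hx
    exact (e.left_inv hx).symm
  rw [g.pullback_congr hF_eq, g.pullback_comp hψ (hC.differentiableAt (by simp))]
  rfl

theorem pullback_eventuallyEq_coord (he : e ∈ atlas E M)
    (hF : ContMDiffAt 𝓘(ℝ, X) 𝓘(ℝ, E) 1 F z) (hz : F z ∈ e.source) :
    g.pullback F =ᶠ[𝓝 z] fun x ↦ (g.coord e ((e ∘ F) x)).bilinearComp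
      (fderiv ℝ (e ∘ F) x) (fderiv ℝ (e ∘ F) x) := by
  filter_upwards [(contMDiffAt_iff_contMDiffAt_nhds (by simp)).1 hF,
    hF.continuousAt.eventually_mem (e.open_source.mem_nhds hz)] with x hx hxe
  exact g.pullback_eq_coord he hx hxe

/-- Metric compatibility of the Levi-Civita connection, along the map `F`. -/
theorem fderiv_pullback_apply [FiniteDimensional ℝ E] (he : e ∈ atlas E M)
    (hF : ContMDiffAt 𝓘(ℝ, X) 𝓘(ℝ, E) 2 F z) (hz : F z ∈ e.source) (w a b : X) :
    fderiv ℝ (g.pullback F) z w a b =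
      g.coord e (e (F z)) (g.coordHessian e F z w a) (fderiv ℝ (e ∘ F) z b) +
      g.coord e (e (F z)) (fderiv ℝ (e ∘ F) z a) (g.coordHessian e F z w b) := by
  have hC : ContDiffAt ℝ 2 (e ∘ F) z := contDiffAt_chart_comp he (by norm_cast) hF hz
  have hdC : DifferentiableAt ℝ (fderiv ℝ (e ∘ F)) z :=
    (hC.fderiv_right (m := 1) (by norm_num)).differentiableAt (by simp)
  have hp : e (F z) ∈ e.target := e.map_source hz
  rw [(g.pullback_eventuallyEq_coord he (hF.of_le (by norm_cast)) hz).fderiv_eq,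
    fderiv_bilinearComp_apply (C := e ∘ F) (g.differentiableAt_coord he hp)
      (hC.differentiableAt (by simp)) hdC,
    Function.comp_apply, g.fderiv_coord_eq_christoffel he hp]
  simp only [coordHessian, map_add, add_apply]
  ring

/-- Polarization of `∇_b(dF b) = 0`: the torsion-freeness `∇_b(dF a) = ∇_a(dF b)` turns the
derivative of `g(dF a, dF b)` along `b` into half the derivative of `g(dF b, dF b)` along `a`. -/
theorem two_mul_fderiv_pullback_apply [FiniteDimensional ℝ E] (he : e ∈ atlas E M)
    (hF : ContMDiffAt 𝓘(ℝ, X) 𝓘(ℝ, E) 2 F z) (hz : F z ∈ e.source) {b : X}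
    (hb : g.coordHessian e F z b b = 0) (a : X) :
    2 * fderiv ℝ (g.pullback F) z b a b = fderiv ℝ (g.pullback F) z a b b := by
  have hcomm : g.coord e (e (F z)) (fderiv ℝ (e ∘ F) z b) (g.coordHessian e F z a b) =
      g.coord e (e (F z)) (g.coordHessian e F z a b) (fderiv ℝ (e ∘ F) z b) :=
    g.pullback_symm e.symm _ _ _
  rw [g.fderiv_pullback_apply he hF hz, g.fderiv_pullback_apply he hF hz, hb, map_zero, add_zero,
    g.coordHessian_symm (contDiffAt_chart_comp he (by norm_cast) hF hz) b a, hcomm, two_mul]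

theorem fderiv_pullback_self [FiniteDimensional ℝ E] (he : e ∈ atlas E M)
    (hF : ContMDiffAt 𝓘(ℝ, X) 𝓘(ℝ, E) 2 F z) (hz : F z ∈ e.source) {b : X}
    (hb : g.coordHessian e F z b b = 0) : fderiv ℝ (g.pullback F) z b b b = 0 := by
  linarith [g.two_mul_fderiv_pullback_apply he hF hz hb b]

end Hessian

end PseudoRiemannianMetric

section GeodesicFamily

open Function

namespace PseudoRiemannianMetric

variable {E : Type*} [NormedAddCommGroup E] [NormedSpace ℝ E]
  {M : Type*} [TopologicalSpace M] [ChartedSpace E M] [IsManifold 𝓘(ℝ, E) ∞ M]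
  {g : PseudoRiemannianMetric E M}

theorem coordHessian_uncurry_time (g : PseudoRiemannianMetric E M)
    {X : Type*} [NormedAddCommGroup X] [NormedSpace ℝ X]
    {e : OpenPartialHomeomorph M E} {Γ : X → ℝ → M} {x : X} {t : ℝ}
    (hC : ContDiffAt ℝ 2 (e ∘ uncurry Γ) (x, t)) :
    g.coordHessian e (uncurry Γ) (x, t) (0, 1) (0, 1) = deriv (deriv (e ∘ Γ x)) t +
      g.christoffel e (e (Γ x t)) (deriv (e ∘ Γ x) t) (deriv (e ∘ Γ x) t) := by
  have hfst : deriv (e ∘ Γ x) t = fderiv ℝ (e ∘ uncurry Γ) (x, t) (0, 1) :=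
    (hasDerivAt_comp_prodMk_right (hC.differentiableAt (by simp))).deriv
  have hsnd : deriv (deriv (e ∘ Γ x)) t =
      fderiv ℝ (fderiv ℝ (e ∘ uncurry Γ)) (x, t) (0, 1) (0, 1) :=
    deriv_deriv_comp_prodMk_right hC
  rw [hfst, hsnd]
  rfl

namespace IsSmoothGeodesicFamily

variable {Γ : ℝ → ℝ → M} {Il It : Set ℝ} {l t : ℝ}

theorem contMDiffAt (hΓ : g.IsSmoothGeodesicFamily Γ Il It) (hl : l ∈ Il) (ht : t ∈ It) :
    ContMDiffAt 𝓘(ℝ, ℝ × ℝ) 𝓘(ℝ, E) ∞ (uncurry Γ) (l, t) :=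
  hΓ.contMDiffOn.contMDiffAt ((hΓ.isOpen_param.prod hΓ.isOpen_time).mem_nhds ⟨hl, ht⟩)

theorem mdifferentiableAt (hΓ : g.IsSmoothGeodesicFamily Γ Il It) (hl : l ∈ Il) (ht : t ∈ It) :
    MDifferentiableAt 𝓘(ℝ, ℝ × ℝ) 𝓘(ℝ, E) (uncurry Γ) (l, t) :=
  (hΓ.contMDiffAt hl ht).mdifferentiableAt (by simp)

theorem mdifferentiableAt_graph (hΓ : g.IsSmoothGeodesicFamily Γ Il It) {τ : ℝ → ℝ}
    (hτ : DifferentiableAt ℝ τ l) (hl : l ∈ Il) (hτl : τ l ∈ It) :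
    MDifferentiableAt 𝓘(ℝ, ℝ) 𝓘(ℝ, E) (fun s ↦ Γ s (τ s)) l :=
  MDifferentiableAt.comp (g := uncurry Γ) (f := fun s ↦ (s, τ s)) l
    (hΓ.mdifferentiableAt hl hτl) (differentiableAt_id.prodMk hτ).mdifferentiableAt

theorem coordHessian_time_time (hΓ : g.IsSmoothGeodesicFamily Γ Il It) (hl : l ∈ Il) (ht : t ∈ It)
    {e : OpenPartialHomeomorph M E} (he : e ∈ atlas E M) (hlt : Γ l t ∈ e.source) :
    g.coordHessian e (uncurry Γ) (l, t) (0, 1) (0, 1) = 0 := by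
  have hC : ContDiffAt ℝ ∞ (e ∘ uncurry Γ) (l, t) :=
    contDiffAt_chart_comp he le_rfl (hΓ.contMDiffAt hl ht) hlt
  rw [g.coordHessian_uncurry_time (hC.of_le (by norm_cast))]
  exact (hΓ.isGeodesicOn l hl).geodesic_eq t ht e he hlt

theorem val_velocity_time_time (hΓ : g.IsSmoothGeodesicFamily Γ Il It) (hl : l ∈ Il)
    (ht : t ∈ It) : g.val (Γ l t) (velocity (Γ l) t) (velocity (Γ l) t) =
      g.pullback (uncurry Γ) (l, t) (0, 1) (0, 1) := by
  rw [velocity_eq_mfderiv_uncurry (hΓ.mdifferentiableAt hl ht)]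
  rfl

theorem val_velocity_graph_time (hΓ : g.IsSmoothGeodesicFamily Γ Il It) {τ : ℝ → ℝ}
    (hτ : DifferentiableAt ℝ τ l) (hl : l ∈ Il) (hτl : τ l ∈ It) :
    g.val (Γ l (τ l)) (velocity (fun s ↦ Γ s (τ s)) l) (velocity (Γ l) (τ l)) =
      g.pullback (uncurry Γ) (l, τ l) (1, deriv τ l) (0, 1) := by
  rw [velocity_graph (hΓ.mdifferentiableAt hl hτl) hτ,
    velocity_eq_mfderiv_uncurry (hΓ.mdifferentiableAt hl hτl)]
  rfl

theorem differentiableAt_pullback (hΓ : g.IsSmoothGeodesicFamily Γ Il It) (hl : l ∈ Il)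
    (ht : t ∈ It) : DifferentiableAt ℝ (g.pullback (uncurry Γ)) (l, t) :=
  ((g.contDiffOn_pullback (hΓ.isOpen_param.prod hΓ.isOpen_time) hΓ.contMDiffOn).contDiffAt
    ((hΓ.isOpen_param.prod hΓ.isOpen_time).mem_nhds ⟨hl, ht⟩)).differentiableAt (by simp)

variable [FiniteDimensional ℝ E]

theorem fderiv_pullback_time_time (hΓ : g.IsSmoothGeodesicFamily Γ Il It) (hl : l ∈ Il)
    (ht : t ∈ It) : fderiv ℝ (g.pullback (uncurry Γ)) (l, t) (0, 1) (0, 1) (0, 1) = 0 :=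
  g.fderiv_pullback_self (chart_mem_atlas E _) ((hΓ.contMDiffAt hl ht).of_le (by norm_cast))
    (mem_chart_source E _)
    (hΓ.coordHessian_time_time hl ht (chart_mem_atlas E _) (mem_chart_source E _))

theorem two_mul_fderiv_pullback_param_time (hΓ : g.IsSmoothGeodesicFamily Γ Il It) (hl : l ∈ Il)
    (ht : t ∈ It) : 2 * fderiv ℝ (g.pullback (uncurry Γ)) (l, t) (0, 1) (1, 0) (0, 1) =
      fderiv ℝ (g.pullback (uncurry Γ)) (l, t) (1, 0) (0, 1) (0, 1) :=
  g.two_mul_fderiv_pullback_apply (chart_mem_atlas E _)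
    ((hΓ.contMDiffAt hl ht).of_le (by norm_cast)) (mem_chart_source E _)
    (hΓ.coordHessian_time_time hl ht (chart_mem_atlas E _) (mem_chart_source E _)) (1, 0)

theorem pullback_time_time (hΓ : g.IsSmoothGeodesicFamily Γ Il It) (h0 : (0 : ℝ) ∈ It)
    (hl : l ∈ Il) (ht : t ∈ It) :
    g.pullback (uncurry Γ) (l, t) (0, 1) (0, 1) = g.energy Γ l := by
  have hderiv : ∀ s ∈ It,
      HasDerivAt (fun s ↦ g.pullback (uncurry Γ) (l, s) (0, 1) (0, 1)) 0 s := fun s hs ↦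
    (g.hasDerivAt_pullback_apply (hΓ.differentiableAt_pullback hl hs)
      (hasDerivAt_prodMk_right l s) (0, 1) (0, 1)).congr_deriv
      (hΓ.fderiv_pullback_time_time hl hs)
  exact (hΓ.isOpen_time.is_const_of_deriv_eq_zero hΓ.ordConnected_time.isPreconnected
    (fun s hs ↦ (hderiv s hs).differentiableAt.differentiableWithinAt)
    (fun s hs ↦ (hderiv s hs).deriv) ht h0).trans (hΓ.val_velocity_time_time hl h0).symm

theorem val_velocity_eq_energy (hΓ : g.IsSmoothGeodesicFamily Γ Il It) (h0 : (0 : ℝ) ∈ It)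
    (hl : l ∈ Il) (ht : t ∈ It) :
    g.val (Γ l t) (velocity (Γ l) t) (velocity (Γ l) t) = g.energy Γ l :=
  (hΓ.val_velocity_time_time hl ht).trans (hΓ.pullback_time_time h0 hl ht)

theorem hasDerivAt_energy (hΓ : g.IsSmoothGeodesicFamily Γ Il It) (h0 : (0 : ℝ) ∈ It)
    (hl : l ∈ Il) (ht : t ∈ It) : HasDerivAt (g.energy Γ)
      (fderiv ℝ (g.pullback (uncurry Γ)) (l, t) (1, 0) (0, 1) (0, 1)) l := by
  have hpull := g.hasDerivAt_pullback_apply (c := fun s ↦ (s, t))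
    (hΓ.differentiableAt_pullback hl ht) ((hasDerivAt_id l).prodMk (hasDerivAt_const l t))
    (0, 1) (0, 1)
  refine hpull.congr_of_eventuallyEq ?_
  filter_upwards [hΓ.isOpen_param.mem_nhds hl] with s hs
  exact (hΓ.pullback_time_time h0 hs ht).symm

theorem hasDerivAt_two_mul_pullback_param_time (hΓ : g.IsSmoothGeodesicFamily Γ Il It)
    (h0 : (0 : ℝ) ∈ It) (hl : l ∈ Il) (ht : t ∈ It) :
    HasDerivAt (fun s ↦ 2 * g.pullback (uncurry Γ) (l, s) (1, 0) (0, 1))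
      (deriv (g.energy Γ) l) t := by
  rw [(hΓ.hasDerivAt_energy h0 hl ht).deriv, ← hΓ.two_mul_fderiv_pullback_param_time hl ht]
  exact (g.hasDerivAt_pullback_apply (hΓ.differentiableAt_pullback hl ht)
    (hasDerivAt_prodMk_right l t) (1, 0) (0, 1)).const_mul 2

theorem two_mul_pullback_param_time (hΓ : g.IsSmoothGeodesicFamily Γ Il It)
    (h0 : (0 : ℝ) ∈ It) (hl : l ∈ Il) (ht : t ∈ It) :
    2 * g.pullback (uncurry Γ) (l, t) (1, 0) (0, 1) =
      2 * g.pullback (uncurry Γ) (l, 0) (1, 0) (0, 1) + deriv (g.energy Γ) l * t := by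
  have hlhs := fun s (hs : s ∈ It) ↦ hΓ.hasDerivAt_two_mul_pullback_param_time h0 hl hs
  have hrhs : ∀ s, HasDerivAt (fun s ↦ 2 * g.pullback (uncurry Γ) (l, 0) (1, 0) (0, 1) +
      deriv (g.energy Γ) l * s) (deriv (g.energy Γ) l) s := fun s ↦ by
    simpa using ((hasDerivAt_id s).const_mul (deriv (g.energy Γ) l)).const_add
      (2 * g.pullback (uncurry Γ) (l, 0) (1, 0) (0, 1))
  exact hΓ.isOpen_time.eqOn_of_deriv_eq hΓ.ordConnected_time.isPreconnected
    (fun s hs ↦ (hlhs s hs).differentiableAt.differentiableWithinAt)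
    (fun s _ ↦ (hrhs s).differentiableAt.differentiableWithinAt)
    (fun s hs ↦ (hlhs s hs).deriv.trans (hrhs s).deriv.symm) h0 (by simp) ht

theorem first_variation (hΓ : g.IsSmoothGeodesicFamily Γ Il It) (h0 : (0 : ℝ) ∈ It)
    {τ : ℝ → ℝ} (hτ : DifferentiableAt ℝ τ l) (hl : l ∈ Il) (hτl : τ l ∈ It) :
    2 * g.energy Γ l * deriv τ l + deriv (g.energy Γ) l * τ l =
      2 * g.val (Γ l (τ l)) (velocity (fun s ↦ Γ s (τ s)) l) (velocity (Γ l) (τ l)) -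
      2 * g.val (Γ l 0) (velocity (fun s ↦ Γ s 0) l) (velocity (Γ l) 0) := by
  have hx : g.val (Γ l 0) (velocity (fun s ↦ Γ s 0) l) (velocity (Γ l) 0) =
      g.pullback (uncurry Γ) (l, 0) (1, 0) (0, 1) := by
    simpa only [deriv_const] using
      hΓ.val_velocity_graph_time (τ := fun _ ↦ 0) (differentiableAt_const 0) hl h0
  have hy : g.pullback (uncurry Γ) (l, τ l) (1, deriv τ l) (0, 1) =
      g.pullback (uncurry Γ) (l, τ l) (1, 0) (0, 1) + deriv τ l * g.energy Γ l := by
    have hsplit : ((1, deriv τ l) : ℝ × ℝ) = (1, 0) + deriv τ l • (0, 1) := by simp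
    rw [hsplit, map_add, map_smul, add_apply, smul_apply, hΓ.pullback_time_time h0 hl hτl,
      smul_eq_mul]
  rw [hΓ.val_velocity_graph_time hτ hl hτl, hx, hy]
  linarith [hΓ.two_mul_pullback_param_time h0 hl hτl]

end IsSmoothGeodesicFamily

end PseudoRiemannianMetric

end GeodesicFamily

theorem proposition6p2_general
    {E : Type*} [NormedAddCommGroup E] [NormedSpace ℝ E] [FiniteDimensional ℝ E]
    {M : Type*} [TopologicalSpace M] [ChartedSpace E M] [IsManifold 𝓘(ℝ, E) ∞ M]
    (g : PseudoRiemannianMetric E M) (S : Set M) (Γ : ℝ → ℝ → M) (Il It : Set ℝ)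
    (hΓ : g.IsSmoothGeodesicFamily Γ Il It) (τ₀ : ℝ) (hIl : (0 : ℝ) ∈ Il)
    (hIt : (0 : ℝ) ∈ It) (hτ₀ : τ₀ ∈ It)
    (hS : IsTransversalTo S (velocity (E := E) (Γ 0) τ₀)) :
    ∃ ε > 0, ∃ δ > 0, ∃ τ : ℝ → ℝ,
      Set.Ioo (-ε) ε ⊆ Il ∧ Set.Ioo (τ₀ - δ) (τ₀ + δ) ⊆ It ∧
      τ 0 = τ₀ ∧
      (∀ l ∈ Set.Ioo (-ε) ε, τ l ∈ Set.Ioo (τ₀ - δ) (τ₀ + δ) ∧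
        ∀ t ∈ Set.Ioo (τ₀ - δ) (τ₀ + δ), Γ l t ∈ S ↔ t = τ l) ∧
      (∀ l ∈ Set.Ioo (-ε) ε, IsTransversalTo S (velocity (E := E) (Γ l) (τ l))) ∧
      ContDiffOn ℝ ∞ τ (Set.Ioo (-ε) ε) ∧
      (∀ l ∈ Set.Ioo (-ε) ε, ∀ t ∈ It,
        g.val (Γ l t) (velocity (Γ l) t) (velocity (Γ l) t) = g.energy Γ l) ∧
      (∀ l ∈ Set.Ioo (-ε) ε,
        DifferentiableAt ℝ (g.energy Γ) l ∧
        MDifferentiableAt 𝓘(ℝ, ℝ) 𝓘(ℝ, E) (fun s ↦ Γ s 0) l ∧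
        MDifferentiableAt 𝓘(ℝ, ℝ) 𝓘(ℝ, E) (fun s ↦ Γ s (τ s)) l ∧
        2 * g.energy Γ l * deriv τ l + deriv (g.energy Γ) l * τ l =
          2 * g.val (Γ l (τ l)) (velocity (fun s ↦ Γ s (τ s)) l) (velocity (Γ l) (τ l)) -
          2 * g.val (Γ l 0) (velocity (fun s ↦ Γ s 0) l) (velocity (Γ l) 0)) ∧
      (g.energy Γ 0 = 0 → deriv (g.energy Γ) 0 ≠ 0 →
        τ₀ = 2 / deriv (g.energy Γ) 0 *
          (g.val (Γ 0 (τ 0)) (velocity (fun s ↦ Γ s (τ s)) 0) (velocity (Γ 0) (τ 0)) -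
            g.val (Γ 0 0) (velocity (fun s ↦ Γ s 0) 0) (velocity (Γ 0) 0))) := by
  obtain ⟨ε, hε, δ, hδ, τ, hbox, hτ0, hmeet, htrans, hτ⟩ := hS.exists_hittingTime
    (hΓ.isOpen_param.prod hΓ.isOpen_time) hΓ.contMDiffOn (Set.mk_mem_prod hIl hτ₀)
  simp only [Real.ball_eq_Ioo, zero_sub, zero_add] at hbox hmeet htrans hτ
  have hε0 : (0 : ℝ) ∈ Set.Ioo (-ε) ε := ⟨neg_lt_zero.2 hε, hε⟩
  have hIlε : Set.Ioo (-ε) ε ⊆ Il := fun l hl ↦ (hbox (Set.mk_mem_prod hl (hmeet l hl).1)).1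
  have hItδ : Set.Ioo (τ₀ - δ) (τ₀ + δ) ⊆ It := fun t ht ↦ (hbox (Set.mk_mem_prod hε0 ht)).2
  have hτd : ∀ l ∈ Set.Ioo (-ε) ε, DifferentiableAt ℝ τ l := fun l hl ↦
    (hτ.contDiffAt (isOpen_Ioo.mem_nhds hl)).differentiableAt (by simp)
  have hvar := fun l (hl : l ∈ Set.Ioo (-ε) ε) ↦
    hΓ.first_variation hIt (hτd l hl) (hIlε hl) (hItδ (hmeet l hl).1)
  refine ⟨ε, hε, δ, hδ, τ, hIlε, hItδ, hτ0, hmeet, htrans, hτ,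
    fun l hl t ht ↦ hΓ.val_velocity_eq_energy hIt (hIlε hl) ht,
    fun l hl ↦ ⟨(hΓ.hasDerivAt_energy hIt (hIlε hl) hIt).differentiableAt,
      hΓ.mdifferentiableAt_graph (differentiableAt_const 0) (hIlε hl) hIt,
      hΓ.mdifferentiableAt_graph (hτd l hl) (hIlε hl) (hItδ (hmeet l hl).1), hvar l hl⟩,
    fun hnull henergy ↦ ?_⟩
  have hvar0 := hvar 0 hε0
  rw [hnull, mul_zero, zero_mul, zero_add] at hvar0
  rw [div_mul_eq_mul_div, eq_div_iff henergy, mul_sub, ← hvar0, hτ0, mul_comm]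

theorem proposition6p2
    {E : Type*} [NormedAddCommGroup E] [NormedSpace ℝ E] [FiniteDimensional ℝ E]
    {M : Type*} [TopologicalSpace M] [T2Space M] [SecondCountableTopology M]
    [ChartedSpace E M] [IsManifold 𝓘(ℝ, E) ∞ M]
    (g : PseudoRiemannianMetric E M) (hg : g.IsRiemannian ∨ g.IsLorentzian)
    (H₁ H₂ : Set M) (hH₁ : IsSmoothHypersurface E H₁) (hH₂ : IsSmoothHypersurface E H₂)
    (Γ : ℝ → ℝ → M) (Il It : Set ℝ) (hΓ : g.IsSmoothGeodesicFamily Γ Il It)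
    (τ₀ : ℝ) (hτ₀ : 0 ≤ τ₀) (hIl : (0 : ℝ) ∈ Il) (hIt : Set.Icc 0 τ₀ ⊆ It)
    (hx₀ : Γ 0 0 ∈ H₁)
    (hy₀ : IsTransversalTo H₂ (velocity (E := E) (Γ 0) τ₀)) :
    ∃ ε > 0, ∃ δ > 0, ∃ τ : ℝ → ℝ,
      Set.Ioo (-ε) ε ⊆ Il ∧ Set.Ioo (τ₀ - δ) (τ₀ + δ) ⊆ It ∧
      -- `τ l` is the travel time of `γ_l`: the unique time near `τ₀` at which `γ_l` meets `H₂`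
      τ 0 = τ₀ ∧
      (∀ l ∈ Set.Ioo (-ε) ε, τ l ∈ Set.Ioo (τ₀ - δ) (τ₀ + δ) ∧
        ∀ t ∈ Set.Ioo (τ₀ - δ) (τ₀ + δ), Γ l t ∈ H₂ ↔ t = τ l) ∧
      -- the intersection is transversal, and the travel time is smooth
      (∀ l ∈ Set.Ioo (-ε) ε, IsTransversalTo H₂ (velocity (E := E) (Γ l) (τ l))) ∧
      ContDiffOn ℝ ∞ τ (Set.Ioo (-ε) ε) ∧
      -- `h(l) = g(γ̇_l(t), γ̇_l(t))` does not depend on `t`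
      (∀ l ∈ Set.Ioo (-ε) ε, ∀ t ∈ It,
        g.val (Γ l t) (velocity (Γ l) t) (velocity (Γ l) t) = g.energy Γ l) ∧
      -- the first variation formula, in which `x(l) = γ_l(0)` and `y(l) = γ_l(τ l)`
      (∀ l ∈ Set.Ioo (-ε) ε,
        DifferentiableAt ℝ (g.energy Γ) l ∧
        MDifferentiableAt 𝓘(ℝ, ℝ) 𝓘(ℝ, E) (fun s ↦ Γ s 0) l ∧
        MDifferentiableAt 𝓘(ℝ, ℝ) 𝓘(ℝ, E) (fun s ↦ Γ s (τ s)) l ∧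
        2 * g.energy Γ l * deriv τ l + deriv (g.energy Γ) l * τ l =
          2 * g.val (Γ l (τ l)) (velocity (fun s ↦ Γ s (τ s)) l) (velocity (Γ l) (τ l)) -
          2 * g.val (Γ l 0) (velocity (fun s ↦ Γ s 0) l) (velocity (Γ l) 0)) ∧
      -- recovery of the travel time of a lightlike `γ_0`
      (g.energy Γ 0 = 0 → deriv (g.energy Γ) 0 ≠ 0 →
        τ₀ = 2 / deriv (g.energy Γ) 0 *
          (g.val (Γ 0 (τ 0)) (velocity (fun s ↦ Γ s (τ s)) 0) (velocity (Γ 0) (τ 0)) -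
            g.val (Γ 0 0) (velocity (fun s ↦ Γ s 0) 0) (velocity (Γ 0) 0))) :=
  proposition6p2_general g H₂ Γ Il It hΓ τ₀ hIl (hIt ⟨le_rfl, hτ₀⟩) (hIt ⟨hτ₀, le_rfl⟩) hy₀
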